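/- A topological space $X$ is called \emph{selectively $\omega$-bounded} if for every sequence $(U_n)_{n\in\omega}$ of nonempty open subsets of $X$ there are points $x_n\in U_n$ $(n\in\omega)$ such that some subsequence $(x_{n_k})_{k\in\omega}$ of $(x_n)_{n\in\omega}$ has compact closure in $X$. It is called \emph{countably compact} if every sequence in $X$ has a cluster point, and \emph{pseudocompact} if every continuous real-valued function on $X$ is bounded. Let $C_k(X)$ and $C_p(X)$ denote the space of all continuous real-valued functions on $X$ endowed with the compact-open topology and with the topology of pointwise convergence, respectively. There exists a separable, countably compact Tychonoff space $X$ whose square $X\times X$ is not pseudocompact, such that $X$ is not selectively $\omega$-bounded, and yet every compact subset of $C_k(X)$, and even every compact subset of $C_p(X)$, is metrizable. -/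

import Mathlib

/-- A topological space is pseudocompact if every continuous real-valued function on it is
bounded. -/
def IsPseudocompactSpace (X : Type*) [TopologicalSpace X] : Prop :=
  ∀ f : X → ℝ, Continuous f → ∃ C : ℝ, ∀ x : X, |f x| ≤ C

/-- A topological space is selectively `ω`-bounded if for every sequence `U` of nonempty open
sets one can select points `x n ∈ U n` so that some subsequence of `x` has compact closure. -/
def IsSelectivelyOmegaBounded (X : Type*) [TopologicalSpace X] : Prop :=
  ∀ U : ℕ → Set X, (∀ n, IsOpen (U n)) → (∀ n, (U n).Nonempty) →
    ∃ x : ℕ → X, (∀ n, x n ∈ U n) ∧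
      ∃ φ : ℕ → ℕ, StrictMono φ ∧ IsCompact (closure (Set.range (x ∘ φ)))

/-- `Cp X` is the space of continuous real-valued functions on `X` with the topology of pointwise
convergence, that is, the topology of a subspace of the product `X → ℝ`. (The space `C(X, ℝ)` of
Mathlib carries the compact-open topology.) -/
abbrev Cp (X : Type*) [TopologicalSpace X] : Type _ :=
  {f : X → ℝ // Continuous f}

/-!
The space is a Novák-type subspace `X` of the Stone–Čech compactification `βℕ`, realised as
`Ultrafilter ℕ`. Let `σ` be the involution of `ℕ` swapping `2k` and `2k + 1`; its extension to
`βℕ` has no fixed point, because it exchanges the ultrafilters containing the even numbers with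
those containing the odd ones. The set `X` contains `ℕ`, is countably compact, and contains no free
ultrafilter together with its image under `σ` (`exists_novak_set`).

To construct `X`, one adds for every embedding `q : ℕ → βℕ` an accumulation point of its range,
by transfinite recursion, avoiding the `σ`-images of the points chosen before
(`exists_choice_forall_ne`). There is always room: the range of `q` has at least `#βℕ` accumulation
points (`mk_ultrafilter_le_mk_accPt`), since the extension of `q` to `βℕ` is injective, and there
are at most `#βℕ` embeddings (`mk_nat_fun_ultrafilter_le`), since the separable compact space
`(βℕ)^ℕ` is a continuous image of `βℕ`. So the exact cardinality of `βℕ` is not needed.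

The trace `G` on `X × X` of the graph of `σ` is closed, and it consists of the isolated points
`(n, σ n)`. Hence the function with value `n` at `(n, σ n)` and `0` off `G` is continuous and
unbounded. If a sequence `n₀ < n₁ < ⋯` had compact closure in `X`, then the pairs `(n_k, σ n_k)` would
accumulate at a point of `X × X`, because the second coordinates have a cluster point by countable
compactness; this is impossible as `G` is closed and discrete. So `X` is not selectively
`ω`-bounded, as the singletons `{n}` witness.

The two metrizability claims hold for every separable space: restriction to a countable dense set
is a continuous injection into a metrizable space, and it is an embedding on compact sets.
-/

open Set Filter Topology Cardinal

/-! ### Compact sets of continuous functions on a separable space -/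

theorem IsCompact.metrizableSpace_of_continuous_injective {Y Z : Type*} [TopologicalSpace Y]
    [TopologicalSpace Z] [TopologicalSpace.MetrizableSpace Z] {g : Y → Z} (hg : Continuous g)
    (hinj : Function.Injective g) {K : Set Y} (hK : IsCompact K) :
    TopologicalSpace.MetrizableSpace K := by
  have : CompactSpace K := isCompact_iff_compactSpace.mp hK
  have h : IsClosedEmbedding (fun x : K => g x) :=
    (hg.comp continuous_subtype_val).isClosedEmbedding (hinj.comp Subtype.val_injective)
  exact h.isEmbedding.metrizableSpace

/-- It is enough that the topology on the function space `Y` is finer than that of pointwise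
convergence. -/
theorem IsCompact.metrizableSpace_of_separableSpace {X Y : Type*} [TopologicalSpace X]
    [TopologicalSpace.SeparableSpace X] [TopologicalSpace Y] (e : Y → X → ℝ)
    (he : ∀ x, Continuous fun y => e y x) (hinj : Function.Injective e)
    (hcont : ∀ y, Continuous (e y)) {K : Set Y} (hK : IsCompact K) :
    TopologicalSpace.MetrizableSpace K := by
  obtain ⟨D, hDc, hD⟩ := TopologicalSpace.exists_countable_dense X
  have := hDc.to_subtype
  refine hK.metrizableSpace_of_continuous_injective (g := fun y (d : D) => e y d)
    (continuous_pi fun d => he d) fun y z hyz => hinj ?_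
  exact (hcont y).ext_on hD (hcont z) fun d hd => congrFun hyz ⟨d, hd⟩

/-! ### Cardinality of accumulation sets in `βℕ` -/

theorem mk_nat_fun_ultrafilter_le : #(ℕ → Ultrafilter ℕ) ≤ #(Ultrafilter ℕ) := by
  have : TopologicalSpace.SeparableSpace (Ultrafilter ℕ) :=
    ⟨range pure, countable_range _, denseRange_pure⟩
  set u := TopologicalSpace.denseSeq (ℕ → Ultrafilter ℕ)
  -- The extension to `βℕ` of a dense sequence has compact dense range, so it is surjective.
  have hc : Continuous (Ultrafilter.extend u) := continuous_ultrafilter_extend u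
  have hd : DenseRange (Ultrafilter.extend u) := by
    refine (TopologicalSpace.denseRange_denseSeq (ℕ → Ultrafilter ℕ)).mono ?_
    rintro _ ⟨n, rfl⟩
    exact ⟨pure n, ultrafilter_extend_pure u n⟩
  refine mk_le_of_surjective (f := Ultrafilter.extend u) (range_eq_univ.mp ?_)
  rw [← (isCompact_range hc).isClosed.closure_eq, hd.closure_eq]

theorem aleph0_lt_mk_ultrafilter : ℵ₀ < #(Ultrafilter ℕ) := by
  refine lt_of_lt_of_le ?_ mk_nat_fun_ultrafilter_le
  have h2 : (2 : Cardinal) ≤ #(Ultrafilter ℕ) := by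
    rw [two_le_iff]
    exact ⟨pure 0, pure 1, fun h => zero_ne_one (Ultrafilter.pure_injective h)⟩
  calc ℵ₀ < 2 ^ ℵ₀ := cantor _
    _ ≤ #(Ultrafilter ℕ) ^ ℵ₀ := power_le_power_right h2
    _ = #(ℕ → Ultrafilter ℕ) := by simp

/-- A discrete sequence of ultrafilters can be separated by a family of pairwise disjoint sets
`A n`; for `B` the union of the `A n` over `n ∈ C` this gives the following. -/
theorem Topology.IsEmbedding.exists_set_mem_ultrafilter_iff {q : ℕ → Ultrafilter ℕ}
    (hq : IsEmbedding q) (C : Set ℕ) : ∃ B : Set ℕ, ∀ n, B ∈ q n ↔ n ∈ C := by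
  have hA : ∀ n, ∃ A : Set ℕ, A ∈ q n ∧ ∀ m, A ∈ q m → m = n := by
    intro n
    obtain ⟨W, hW, hWn⟩ := hq.isInducing.isOpen_iff.mp (isOpen_discrete ({n} : Set ℕ))
    have hn : q n ∈ W := by
      change n ∈ q ⁻¹' W
      rw [hWn]; rfl
    obtain ⟨_, ⟨A, rfl⟩, hAn, hAW⟩ := ultrafilterBasis_is_basis.exists_subset_of_mem_open hn hW
    refine ⟨A, hAn, fun m hm => ?_⟩
    have : m ∈ q ⁻¹' W := hAW hm
    rwa [hWn] at this
  choose A hAn hAm using hA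
  have hfirst : ∀ n, {k | k ∈ A n ∧ ∀ m < n, k ∉ A m} ∈ q n := by
    intro n
    refine inter_mem (hAn n) ?_
    have : (⋂ m ∈ Iio n, (A m)ᶜ) ∈ (q n : Filter ℕ) := by
      rw [biInter_mem (finite_Iio n)]
      intro m hm
      rw [Ultrafilter.mem_coe, Ultrafilter.compl_mem_iff_notMem]
      exact fun h => (ne_of_gt hm) (hAm m n h)
    refine mem_of_superset this fun k hk m hm => ?_
    simp only [mem_iInter] at hk
    exact hk m hm
  refine ⟨{k | ∃ n ∈ C, k ∈ A n ∧ ∀ m < n, k ∉ A m}, fun n => ⟨fun h => ?_, fun h => ?_⟩⟩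
  · obtain ⟨k, ⟨m, hmC, hkm, hkm'⟩, hkn, hkn'⟩ := (q n).nonempty_of_mem (inter_mem h (hfirst n))
    rcases lt_trichotomy m n with hlt | rfl | hlt
    · exact absurd hkm (hkn' m hlt)
    · exact hmC
    · exact absurd hkn (hkm' n hlt)
  · exact mem_of_superset (hfirst n) fun k hk => ⟨n, h, hk⟩

theorem Topology.IsEmbedding.bind_ultrafilter_injective {q : ℕ → Ultrafilter ℕ}
    (hq : IsEmbedding q) : Function.Injective fun u : Ultrafilter ℕ => u.bind q := by
  intro u v huv
  ext C
  obtain ⟨B, hB⟩ := hq.exists_set_mem_ultrafilter_iff C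
  have key : ∀ w : Ultrafilter ℕ, B ∈ w.bind q ↔ C ∈ w := fun w => by
    change {n | B ∈ q n} ∈ w ↔ C ∈ w
    simp only [hB, ofPred_mem_eq]
  rw [← key u, ← key v]
  exact iff_of_eq (congrArg (B ∈ ·) huv)

theorem Ultrafilter.bind_mem_closure_range (q : ℕ → Ultrafilter ℕ) (u : Ultrafilter ℕ) :
    u.bind q ∈ closure (range q) :=
  mem_closure_iff_ultrafilter.mpr ⟨u.map q, range_mem_map, ultrafilter_converges_iff.mpr rfl⟩

theorem mk_ultrafilter_le_mk_accPt {q : ℕ → Ultrafilter ℕ} (hq : IsEmbedding q) :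
    #(Ultrafilter ℕ) ≤ #{p : Ultrafilter ℕ | AccPt p (𝓟 (range q))} := by
  set S := {p : Ultrafilter ℕ | AccPt p (𝓟 (range q))}
  have hsub : range (fun u : Ultrafilter ℕ => u.bind q) ⊆ S ∪ range q := by
    rintro _ ⟨u, rfl⟩
    by_cases h : u.bind q ∈ range q
    · exact Or.inr h
    · left
      change AccPt _ _
      rw [accPt_principal_iff_clusterPt, sdiff_singleton_eq_self h, ← mem_closure_iff_clusterPt]
      exact u.bind_mem_closure_range q
  have hle : #(Ultrafilter ℕ) ≤ #S + ℵ₀ :=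
    calc #(Ultrafilter ℕ) = #(range fun u : Ultrafilter ℕ => u.bind q) :=
          (mk_range_eq _ hq.bind_ultrafilter_injective).symm
      _ ≤ #(S ∪ range q : Set _) := mk_le_mk_of_subset hsub
      _ ≤ #S + #(range q) := mk_union_le _ _
      _ ≤ #S + ℵ₀ := by gcongr; exact (countable_range q).le_aleph0
  by_contra! hlt
  exact (hle.trans_lt (add_lt_of_lt aleph0_lt_mk_ultrafilter.le hlt aleph0_lt_mk_ultrafilter)).false

/-! ### The Novák subspace -/

/-- Points are chosen by recursion along a well-order of `ι` in its least order type; each step has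
fewer than `#Y` earlier choices to avoid. -/
theorem exists_choice_forall_ne {ι Y : Type} (τ : Y → Y) (hτ : Function.Involutive τ)
    (hfix : ∀ y, τ y ≠ y) (hι : #ι ≤ #Y) (S : ι → Set Y) (hS : ∀ i, #Y ≤ #(S i)) :
    ∃ p : ι → Y, (∀ i, p i ∈ S i) ∧ ∀ i j, p i ≠ τ (p j) := by
  obtain ⟨_, _, hord⟩ := exists_ord_eq_type_lt ι
  have step : ∀ (i : ι) (f : Iio i → Y), ∃ y ∈ S i, ∀ j, y ≠ τ (f j) := by
    intro i f
    by_contra! h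
    have hsub : S i ⊆ range fun j => τ (f j) := fun y hy => by
      obtain ⟨j, hj⟩ := h y hy
      exact ⟨j, hj.symm⟩
    exact (((hS i).trans (mk_le_mk_of_subset hsub)).trans mk_range_le).not_gt
      ((mk_Iio_lt i hord).trans_le hι)
  choose F hFS hF using step
  let p : ι → Y := wellFounded_lt.fix fun i f => F i fun j => f j j.2
  have hp : ∀ i, p i = F i fun j => p j := fun i => wellFounded_lt.fix_eq _ i
  have hlt : ∀ i j, j < i → p i ≠ τ (p j) := fun i j hj => by
    rw [hp i]
    exact hF i (fun j => p j) ⟨j, hj⟩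
  refine ⟨p, fun i => hp i ▸ hFS i _, fun i j => ?_⟩
  rcases lt_trichotomy i j with h | rfl | h
  · exact fun e => hlt j i h (by rw [e, hτ])
  · exact (hfix _).symm
  · exact hlt i j h

/-- The involution of `ℕ` exchanging `2 * k` and `2 * k + 1`. -/
def swapParity (n : ℕ) : ℕ := if n % 2 = 0 then n + 1 else n - 1

theorem swapParity_involutive : Function.Involutive swapParity := fun n => by
  unfold swapParity
  split_ifs <;> omega

theorem map_swapParity_involutive :
    Function.Involutive (Ultrafilter.map swapParity) := fun u => by
  rw [Ultrafilter.map_map, swapParity_involutive.comp_self, Ultrafilter.map_id]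

theorem map_swapParity_ne (u : Ultrafilter ℕ) : u.map swapParity ≠ u := by
  intro h
  have hiff : {n | n % 2 = 0} ∈ u ↔ {n | n % 2 = 0}ᶜ ∈ u := by
    conv_lhs => rw [← h, Ultrafilter.mem_map]
    have : swapParity ⁻¹' {n | n % 2 = 0} = {n | n % 2 = 0}ᶜ := by
      ext n
      simp only [mem_preimage, mem_ofPred_eq, mem_compl_iff, swapParity]
      split_ifs <;> omega
    rw [this]
  rw [Ultrafilter.compl_mem_iff_notMem] at hiff
  exact iff_not_self hiff

theorem exists_novak_set :
    ∃ X : Set (Ultrafilter ℕ), range pure ⊆ X ∧ IsCountablyCompact X ∧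
      ∀ p ∈ X, p.map swapParity ∈ X → p ∈ range pure := by
  obtain ⟨p, hpS, hp⟩ := exists_choice_forall_ne (ι := {q : ℕ → Ultrafilter ℕ // IsEmbedding q})
    (Ultrafilter.map swapParity) map_swapParity_involutive map_swapParity_ne
    ((mk_subtype_le _).trans mk_nat_fun_ultrafilter_le)
    (fun q => {p | AccPt p (𝓟 (range q.1))}) fun q => mk_ultrafilter_le_mk_accPt q.2
  refine ⟨range pure ∪ range p, subset_union_left, ?_, ?_⟩
  · rw [isCountablyCompact_iff_infinite_subset_has_accPt]
    intro B _ hB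
    have := hB.to_subtype
    obtain ⟨f, hf⟩ := exists_topology_isEmbedding_nat B
    let q : {q : ℕ → Ultrafilter ℕ // IsEmbedding q} :=
      ⟨fun n => f n, IsEmbedding.subtypeVal.comp hf⟩
    refine ⟨p q, Or.inr ⟨q, rfl⟩, (hpS q).mono (principal_mono.mpr ?_)⟩
    rintro _ ⟨n, rfl⟩
    exact (f n).2
  · rintro u (hu | ⟨i, rfl⟩) hX
    · exact hu
    · rcases hX with ⟨n, hn⟩ | ⟨j, hj⟩
      · refine ⟨swapParity n, ?_⟩
        rw [← map_swapParity_involutive (p i), ← hn, Ultrafilter.map_pure]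
      · exact absurd hj (hp j i)

/-! ### The graph of the involution in the square -/

theorem continuous_ultrafilter_map (f : ℕ → ℕ) : Continuous (Ultrafilter.map f) := by
  refine ultrafilterBasis_is_basis.continuous_iff.mpr ?_
  rintro _ ⟨s, rfl⟩
  exact ultrafilter_isOpen_basic (f ⁻¹' s)

theorem isOpen_singleton_pure (n : ℕ) : IsOpen {(pure n : Ultrafilter ℕ)} := by
  convert ultrafilter_isOpen_basic {n} using 1
  ext u
  constructor
  · rintro rfl
    exact mem_pure.mpr rfl
  · intro h
    exact Ultrafilter.coe_injective (u.neBot.eq_pure_iff.mpr h)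

section NovakSquare

variable {X : Set (Ultrafilter ℕ)}

theorem isClosed_graph_map_swapParity :
    IsClosed {z : X × X | (z.1 : Ultrafilter ℕ).map swapParity = z.2} :=
  isClosed_eq ((continuous_ultrafilter_map _).comp (continuous_subtype_val.comp continuous_fst))
    (continuous_subtype_val.comp continuous_snd)

theorem isOpen_singleton_mk_pure {n : ℕ} (h : pure n ∈ X) : IsOpen {(⟨pure n, h⟩ : X)} := by
  convert (isOpen_singleton_pure n).preimage (continuous_subtype_val (p := (· ∈ X))) using 1
  ext x
  simp [Subtype.ext_iff]

theorem not_isPseudocompactSpace_prod (hX : range pure ⊆ X)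
    (hσ : ∀ p ∈ X, p.map swapParity ∈ X → p ∈ range pure) : ¬ IsPseudocompactSpace (X × X) := by
  classical
  set G := {z : X × X | (z.1 : Ultrafilter ℕ).map swapParity = z.2} with hG
  let ν : ℕ → X := fun n => ⟨pure n, hX ⟨n, rfl⟩⟩
  have hν : Function.Injective ν := fun m n h =>
    Ultrafilter.pure_injective (congrArg Subtype.val h)
  have hνG : ∀ n, (ν n, ν (swapParity n)) ∈ G := fun n => Ultrafilter.map_pure _ _
  have hGν : ∀ z ∈ G, ∃ n, z = (ν n, ν (swapParity n)) := by
    rintro ⟨⟨x, hx⟩, ⟨y, hy⟩⟩ (rfl : x.map swapParity = y)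
    obtain ⟨n, rfl⟩ := hσ x hx hy
    exact ⟨n, by simp [ν, Ultrafilter.map_pure]⟩
  have hopen : ∀ n, IsOpen {(ν n, ν (swapParity n))} := fun n => by
    rw [← singleton_prod_singleton]
    exact (isOpen_singleton_mk_pure _).prod (isOpen_singleton_mk_pure _)
  let f : X × X → ℝ := fun z => if z ∈ G then ((Function.invFun ν z.1 : ℕ) : ℝ) else 0
  have hf : Continuous f := by
    rw [continuous_iff_continuousAt]
    intro z
    by_cases hz : z ∈ G
    · obtain ⟨n, rfl⟩ := hGν z hz
      exact continuousAt_of_tendsto_nhds (y := f _)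
        (by rw [(isOpen_singleton_iff_nhds_eq_pure _).mp (hopen n)]; exact tendsto_pure_nhds f _)
    · refine ContinuousAt.congr (f := fun _ => (0 : ℝ)) continuousAt_const ?_
      filter_upwards [isClosed_graph_map_swapParity.isOpen_compl.mem_nhds hz] with w hw
      exact (if_neg hw).symm
  intro h
  obtain ⟨C, hC⟩ := h f hf
  obtain ⟨n, hn⟩ := exists_nat_gt C
  have := hC (ν n, ν (swapParity n))
  simp only [f, if_pos (hνG n), Function.leftInverse_invFun hν n, Nat.abs_cast] at this
  exact this.not_gt hn

theorem not_isSelectivelyOmegaBounded (hX : range pure ⊆ X) (hcc : CountablyCompactSpace X)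
    (hσ : ∀ p ∈ X, p.map swapParity ∈ X → p ∈ range pure) : ¬ IsSelectivelyOmegaBounded X := by
  intro h
  let ν : ℕ → X := fun n => ⟨pure n, hX ⟨n, rfl⟩⟩
  obtain ⟨x, hx, φ, hφ, hK⟩ := h (fun n => {ν n}) (fun n => isOpen_singleton_mk_pure _)
    fun n => singleton_nonempty _
  obtain rfl : x = ν := funext hx
  obtain ⟨y, -, hy⟩ := isCountablyCompact_univ_iff.mpr hcc
    (f := map (fun k => ν (swapParity (φ k))) atTop) (by simp)
  -- Along an ultrafilter `U` at infinity both coordinates converge: the second one to the cluster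
  -- point `y`, the first one by compactness.
  obtain ⟨U, hU, hUy⟩ := mapClusterPt_iff_ultrafilter.mp hy
  obtain ⟨a, -, ha⟩ := hK.ultrafilter_le_nhds (U.map (ν ∘ φ))
    (le_principal_iff.mpr (mem_of_superset range_mem_map subset_closure))
  have hmem : (a, y) ∈ {z : X × X | (z.1 : Ultrafilter ℕ).map swapParity = z.2} :=
    isClosed_graph_map_swapParity.mem_of_tendsto (Tendsto.prodMk_nhds ha hUy)
      (Eventually.of_forall fun k => Ultrafilter.map_pure _ _)
  obtain ⟨n, hn⟩ := hσ a a.2 <| by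
    rw [show (a : Ultrafilter ℕ).map swapParity = y from hmem]
    exact y.2
  obtain rfl : ν n = a := Subtype.ext hn
  have hev : ∀ᶠ k in (U : Filter ℕ), ν (φ k) = ν n :=
    ha ((isOpen_singleton_mk_pure _).mem_nhds rfl)
  have hgt : ∀ᶠ k in (U : Filter ℕ), n < φ k := hU (hφ.tendsto_atTop.eventually_gt_atTop n)
  obtain ⟨k, hk, hk'⟩ := (hev.and hgt).exists
  exact hk'.ne' (Ultrafilter.pure_injective (congrArg Subtype.val hk))

theorem separableSpace_of_range_pure_subset (hX : range pure ⊆ X) :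
    TopologicalSpace.SeparableSpace X := by
  refine ⟨range fun n => (⟨pure n, hX ⟨n, rfl⟩⟩ : X), countable_range _, fun x => ?_⟩
  rw [closure_subtype, ← range_comp]
  exact denseRange_pure x.1

end NovakSquare

theorem mainTheorem3 :
    ∃ (X : Type) (_ : TopologicalSpace X),
      T35Space X ∧
      TopologicalSpace.SeparableSpace X ∧
      CountablyCompactSpace X ∧
      ¬ IsPseudocompactSpace (X × X) ∧
      ¬ IsSelectivelyOmegaBounded X ∧
      (∀ K : Set C(X, ℝ), IsCompact K → TopologicalSpace.MetrizableSpace K) ∧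
      (∀ K : Set (Cp X), IsCompact K → TopologicalSpace.MetrizableSpace K) := by
  obtain ⟨X, hX, hcc, hσ⟩ := exists_novak_set
  have hcc' : CountablyCompactSpace X := isCountablyCompact_iff_countablyCompactSpace.mp hcc
  have := separableSpace_of_range_pure_subset hX
  refine ⟨X, inferInstance, inferInstance, inferInstance, hcc',
    not_isPseudocompactSpace_prod hX hσ, not_isSelectivelyOmegaBounded hX hcc' hσ,
    fun K hK => ?_, fun K hK => ?_⟩
  · exact hK.metrizableSpace_of_separableSpace (fun f x => f x)
      (fun x => continuous_eval_const x) DFunLike.coe_injective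
      fun f => f.continuous
  · exact hK.metrizableSpace_of_separableSpace (fun f x => f.1 x)
      (fun x => (continuous_apply x).comp continuous_subtype_val) Subtype.val_injective
      fun f => f.2
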